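/- Let $p\in(0,1)$ and an integer $r\geqslant 2$ be fixed. For each $n\geqslant 1$, let $G(n,p)$ be the random graph on a fixed set of $n$ vertices in which every two distinct vertices are adjacent independently with probability $p$, and let $K_{1,r}$ be the star with $r$ edges. For a graph $G$, a spanning subgraph $H$ of $G$ is a $K_{1,r}$-saturated subgraph of $G$ if $H$ contains no subgraph isomorphic to $K_{1,r}$, but every graph obtained by adding an edge of $E(G)\setminus E(H)$ to $H$ contains such a subgraph. Let $\mathrm{sat}(G,K_{1,r})$ be the minimum number of edges of a $K_{1,r}$-saturated subgraph of $G$. Then, with high probability, $$\mathrm{sat}\big(G(n,p),K_{1,r}\big)=\frac{(r-1)n}{2}-\big(1+o(1)\big)(r-1)\log_{\frac{1}{1-p}}n .$$ That is, if for $n\geqslant 2$ the random variable $X_n$ is defined by $$\mathrm{sat}\big(G(n,p),K_{1,r}\big)=\frac{(r-1)n}{2}-(1+X_n)(r-1)\log_{\frac{1}{1-p}}n,$$ then $\lim_{n\to\infty}\mathbb{P}\big(|X_n|\leqslant\varepsilon\big)=1$ for every $\varepsilon>0$. -/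

import Mathlib

open Filter Topology

/-- The spanning subgraph `H` of `G` is an `F`-saturated subgraph of `G`: it contains no copy of
`F`, but adding to `H` any edge of `G` that is not in `H` creates a copy of `F`. -/
def SimpleGraph.IsSaturatedSubgraph {V W : Type*} (F : SimpleGraph W) (G H : SimpleGraph V) :
    Prop :=
  H ≤ G ∧ F.Free H ∧
    ∀ u v : V, G.Adj u v → ¬ H.Adj u v → F.IsContained (H ⊔ SimpleGraph.edge u v)

/-- The saturation number `sat(G, F)`: the minimum number of edges of an `F`-saturated
subgraph of `G`. -/
noncomputable def SimpleGraph.satNumber {V W : Type*} (G : SimpleGraph V) (F : SimpleGraph W) :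
    ℕ :=
  sInf {m : ℕ | ∃ H : SimpleGraph V, F.IsSaturatedSubgraph G H ∧ H.edgeSet.ncard = m}

/-- The star `K_{1,r}`. -/
abbrev SimpleGraph.starK (r : ℕ) : SimpleGraph (Fin 1 ⊕ Fin r) :=
  completeBipartiteGraph (Fin 1) (Fin r)

/-- A sequence of real random variables `X n`, each a function of the random graph `G(n, p)`, is
`o(1)` with high probability: for every `ε > 0`, the probability that `|X n| ≤ ε` tends
to `1` as `n` tends to infinity. -/
def SimpleGraph.IsLittleOOneWhp (p : unitInterval) (X : (n : ℕ) → SimpleGraph (Fin n) → ℝ) :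
    Prop :=
  ∀ ε : ℝ, 0 < ε →
    Tendsto (fun n : ℕ => (SimpleGraph.binomialRandom (Fin n) p).real {G | |X n G| ≤ ε})
      atTop (𝓝 1)

/-- A graph on a finite vertex set has an `F`-saturated subgraph as soon as `F` is not contained
in the graph without edges, so the minimum that defines `satNumber` is over a nonempty set. -/
theorem SimpleGraph.exists_isSaturatedSubgraph {V W : Type*} [Finite V] (F : SimpleGraph W)
    (G : SimpleGraph V) (hF : F.Free (⊥ : SimpleGraph V)) :
    ∃ H : SimpleGraph V, F.IsSaturatedSubgraph G H := by
  obtain ⟨H, hH⟩ := (Set.toFinite {H : SimpleGraph V | H ≤ G ∧ F.Free H}).exists_maximal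
    ⟨⊥, bot_le, hF⟩
  refine ⟨H, hH.prop.1, hH.prop.2, fun u v hG hnH => ?_⟩
  by_contra hcon
  have hle : H ⊔ SimpleGraph.edge u v ≤ H :=
    hH.le_of_ge ⟨sup_le hH.prop.1 ((SimpleGraph.edge_le_iff _).2 (Or.inr hG)), hcon⟩ le_sup_left
  exact hnH (hle (Or.inr ((SimpleGraph.edge_adj u v u v).2 ⟨Or.inl ⟨rfl, rfl⟩, hG.ne⟩)))

/-- For `r ≥ 1` the minimum that defines `sat(G, K_{1,r})` is attained. -/
theorem SimpleGraph.exists_ncard_edgeSet_eq_satNumber_starK {V : Type*} [Finite V]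
    (G : SimpleGraph V) (r : ℕ) (hr : 1 ≤ r) :
    ∃ H : SimpleGraph V, (SimpleGraph.starK r).IsSaturatedSubgraph G H ∧
      H.edgeSet.ncard = G.satNumber (SimpleGraph.starK r) := by
  have hF : (SimpleGraph.starK r).Free (⊥ : SimpleGraph V) := by
    rintro ⟨f⟩
    have h : (SimpleGraph.starK r).Adj (Sum.inl 0) (Sum.inr ⟨0, hr⟩) := by simp
    exact f.toHom.map_adj h
  obtain ⟨H, hH⟩ := SimpleGraph.exists_isSaturatedSubgraph (SimpleGraph.starK r) G hF
  exact Nat.sInf_mem (s := {m : ℕ | ∃ H : SimpleGraph V,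
    (SimpleGraph.starK r).IsSaturatedSubgraph G H ∧ H.edgeSet.ncard = m}) ⟨_, H, hH, rfl⟩

/-! ### Star-saturated subgraphs of a fixed graph -/

namespace SimpleGraph

open scoped Classical

variable {V : Type*} [Fintype V]

/-! Write `r = k + 1` and `q = 1 - p`. A subgraph `H` of `G` is `K_{1,k+1}`-saturated exactly when
its degrees are at most `k` and any two deficient vertices (degree below `k`) adjacent in `G` are
already adjacent in `H`. So `2 e(H)` is `k n` minus the total deficiency, and everything depends on
how large the set of deficient vertices can be.

Lower bound: `G` restricted to the deficient vertices lies inside `H`, so it has maximum degree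
below `k`. By a union bound, with high probability no set of slightly more than `2 log_{1/q} n`
vertices of `G(n,p)` is that sparse, and each deficient vertex loses at most `k`.

Upper bound: by the second moment method there is an independent set `S` of nearly `2 log_{1/q} n`
vertices. If some subgraph avoids `S`, has maximum degree at most `k` and is `k`-regular off `S`
except at one vertex, then extending it to a saturated subgraph can spend at most `k` degrees on
`S`, so about `k |S|` is saved (`exists_isSaturatedSubgraph_of_almost_regular`). Such a subgraph is
obtained in `exists_almost_regular` by maximising the number of edges: two deficient vertices
outside `S` would be ends of an augmenting alternating path of five edges. This needs only large
minimum degree and an edge between any two disjoint sets of logarithmic size, both of which hold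
with high probability.

Both bounds put `2 sat` at `k n - (2 + o(1)) k log_{1/q} n`. -/

theorem starK_isContained_iff (r : ℕ) (H : SimpleGraph V) :
    (starK r).IsContained H ↔ ∃ v, r ≤ H.degree v := by
  constructor
  · rintro ⟨f⟩
    refine ⟨f (Sum.inl 0), ?_⟩
    have h : (Finset.univ.image fun i : Fin r => f (Sum.inr i)) ⊆
        H.neighborFinset (f (Sum.inl 0)) := by
      intro x hx
      obtain ⟨i, -, rfl⟩ := Finset.mem_image.1 hx
      rw [mem_neighborFinset]
      exact f.toHom.map_adj (by simp)
    have := Finset.card_le_card h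
    have hinj : Function.Injective fun i : Fin r => f (Sum.inr i) :=
      fun i j hij => Sum.inr_injective (f.injective hij)
    rwa [Finset.card_image_of_injective _ hinj, Finset.card_univ, Fintype.card_fin,
      card_neighborFinset_eq_degree] at this
  · rintro ⟨v, hv⟩
    obtain ⟨g⟩ : Nonempty (Fin r ↪ H.neighborFinset v) :=
      Function.Embedding.nonempty_of_card_le (by
        rwa [Fintype.card_fin, Fintype.card_coe, card_neighborFinset_eq_degree])
    have hg : ∀ i, H.Adj v (g i) := fun i => (mem_neighborFinset _ _ _).1 (g i).2
    refine ⟨⟨⟨Sum.elim (fun _ => v) (fun i => (g i : V)), ?_⟩, ?_⟩⟩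
    · rintro (a | a) (b | b) hab
      · simp at hab
      · exact hg b
      · exact (hg a).symm
      · simp at hab
    · rintro (a | a) (b | b) hab
      · exact congrArg _ (Subsingleton.elim _ _)
      · exact absurd hab (hg b).ne
      · exact absurd hab.symm (hg a).ne
      · exact congrArg _ (g.injective (Subtype.ext hab))

theorem starK_free_iff (k : ℕ) (H : SimpleGraph V) :
    (starK (k + 1)).Free H ↔ ∀ v, H.degree v ≤ k := by
  rw [Free, starK_isContained_iff]
  simp

theorem degree_le_of_le_sup_edge {H K : SimpleGraph V} {u v : V} (h : K ≤ H ⊔ edge u v) (w : V) :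
    K.degree w ≤ H.degree w + if w = u ∨ w = v then 1 else 0 := by
  have hK : ∀ x, K.Adj w x → H.Adj w x ∨ (w = u ∧ x = v ∨ w = v ∧ x = u) := fun x hx => by
    have := h hx
    rw [sup_adj, edge_adj] at this
    exact this.imp_right And.left
  simp only [← card_neighborFinset_eq_degree]
  split_ifs with hw
  · obtain ⟨x, hx⟩ : ∃ x, K.neighborFinset w ⊆ insert x (H.neighborFinset w) := by
      rcases hw with rfl | rfl
      · refine ⟨v, fun y hy => ?_⟩
        simp only [mem_neighborFinset, Finset.mem_insert] at hy ⊢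
        grind
      · refine ⟨u, fun y hy => ?_⟩
        simp only [mem_neighborFinset, Finset.mem_insert] at hy ⊢
        grind
    exact (Finset.card_le_card hx).trans (Finset.card_insert_le _ _)
  · refine Finset.card_le_card fun y hy => ?_
    simp only [mem_neighborFinset] at hy ⊢
    grind

/-- A new edge raises only the degrees of its two ends, each by one, so it creates a star with `k +
1` edges precisely when one end already had degree `k`. -/
theorem isSaturatedSubgraph_starK_iff (k : ℕ) (G H : SimpleGraph V) :
    (starK (k + 1)).IsSaturatedSubgraph G H ↔ H ≤ G ∧ (∀ v, H.degree v ≤ k) ∧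
      ∀ u v, G.Adj u v → ¬ H.Adj u v → H.degree u = k ∨ H.degree v = k := by
  rw [IsSaturatedSubgraph, starK_free_iff]
  refine and_congr_right fun _ => and_congr_right fun hk => ?_
  refine forall₄_congr fun u v huv hn => ?_
  obtain ⟨K, hK⟩ : ∃ K, K = H ⊔ edge u v := ⟨_, rfl⟩
  rw [← hK]
  rw [starK_isContained_iff]
  constructor
  · rintro ⟨w, hw⟩
    have h1 := degree_le_of_le_sup_edge hK.le w
    have h2 := hk w
    split_ifs at h1 with h
    · rcases h with rfl | rfl
      · left; omega
      · right; omega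
    · omega
  · have key : ∀ a b, K.Adj a b → ¬ H.Adj a b → H.degree a = k → k + 1 ≤ K.degree a := by
      intro a b hab hnb ha
      have hHK : H ≤ K := hK ▸ le_sup_left
      have : insert b (H.neighborFinset a) ⊆ K.neighborFinset a := by
        intro y hy
        simp only [mem_neighborFinset, Finset.mem_insert] at hy ⊢
        rcases hy with rfl | hy
        · exact hab
        · exact hHK hy
      have := Finset.card_le_card this
      rwa [Finset.card_insert_of_notMem (by simpa using hnb), card_neighborFinset_eq_degree,
        card_neighborFinset_eq_degree, ha] at this
    have hKuv : K.Adj u v := by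
      rw [hK, sup_adj, edge_adj]
      exact Or.inr ⟨Or.inl ⟨rfl, rfl⟩, huv.ne⟩
    rintro (h | h)
    · exact ⟨u, key u v hKuv hn h⟩
    · exact ⟨v, key v u hKuv.symm (fun h => hn h.symm) h⟩

/-- Twice the number of edges of a star-saturated subgraph falls short of `k n` by at most `k` times
the number of deficient vertices, and these span a graph of small degree. -/
theorem IsSaturatedSubgraph.le_two_mul_ncard_edgeSet {k s : ℕ} {G H : SimpleGraph V}
    (h : (starK (k + 1)).IsSaturatedSubgraph G H)
    (hs : ∀ A : Finset V, A.card = s → ∃ v ∈ A, k ≤ (A.filter (G.Adj v)).card) :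
    k * Fintype.card V + k ≤ 2 * H.edgeSet.ncard + k * s := by
  rw [isSaturatedSubgraph_starK_iff] at h
  obtain ⟨hle, hk, hsat⟩ := h
  set S : Finset V := Finset.univ.filter fun v => H.degree v < k with hS
  have hcard : S.card < s := by
    by_contra! hc
    obtain ⟨A, hAS, hA⟩ := Finset.exists_subset_card_eq hc
    obtain ⟨v, hv, hkv⟩ := hs A hA
    have hvS := hAS hv
    -- Vertices of `A` are deficient, so by saturation every `G`-edge inside `A` is an edge of `H`;
    -- then `v` would have degree at least `k` in `H`.
    have : (A.filter (G.Adj v)) ⊆ H.neighborFinset v := by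
      intro w hw
      rw [Finset.mem_filter] at hw
      rw [mem_neighborFinset]
      by_contra hn
      have hwS := hAS hw.1
      simp only [hS, Finset.mem_filter, Finset.mem_univ, true_and] at hvS hwS
      rcases hsat v w hw.2 hn with h | h <;> omega
    have := Finset.card_le_card this
    rw [card_neighborFinset_eq_degree] at this
    simp only [hS, Finset.mem_filter, Finset.mem_univ, true_and] at hvS
    omega
  have hsum : k * Fintype.card V ≤ ∑ v, H.degree v + k * S.card := by
    have : ∀ v ∈ Finset.univ, k ≤ H.degree v + if v ∈ S then k else 0 := by
      intro v _
      by_cases hv : H.degree v < k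
      · simp [hS, hv]
      · simp only [hS, Finset.mem_filter, Finset.mem_univ, true_and, hv]
        simpa using hv
    have := Finset.sum_le_sum this
    rw [Finset.sum_add_distrib, Finset.sum_ite_mem] at this
    simpa [mul_comm] using this
  rw [sum_degrees_eq_twice_card_edges] at hsum
  have : H.edgeSet.ncard = H.edgeFinset.card := by
    rw [← coe_edgeFinset, Set.ncard_coe_finset]
  rw [this]
  -- The strict inequality `S.card < s` is what yields the extra `k` on the left.
  nlinarith [Nat.mul_le_mul_left k hcard]

/-- Extending an almost `k`-regular subgraph that avoids an independent set to a star-saturated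
subgraph. -/
theorem exists_isSaturatedSubgraph_of_almost_regular {k : ℕ} {G H₀ : SimpleGraph V} {S : Finset V}
    (hS : ∀ u ∈ S, ∀ v ∈ S, ¬ G.Adj u v) (hle : H₀ ≤ G) (hk : ∀ v, H₀.degree v ≤ k)
    (h0 : ∀ u ∈ S, ∀ v, ¬ H₀.Adj u v)
    (hdef : ∀ u v, u ∉ S → v ∉ S → H₀.degree u < k → H₀.degree v < k → u = v) :
    ∃ H, (starK (k + 1)).IsSaturatedSubgraph G H ∧
      2 * H.edgeSet.ncard + k * S.card ≤ k * Fintype.card V + k := by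
  -- Maximality among the graphs of maximum degree at most `k` that contain `H₀` gives saturation:
  -- an edge between two deficient vertices could still be added.
  obtain ⟨H, hH⟩ := (Set.toFinite {H : SimpleGraph V | H ≤ G ∧ (∀ v, H.degree v ≤ k) ∧
    H₀ ≤ H}).exists_maximal ⟨H₀, hle, hk, le_rfl⟩
  obtain ⟨hHG, hHk, hH0⟩ := hH.prop
  refine ⟨H, (isSaturatedSubgraph_starK_iff _ _ _).2 ⟨hHG, hHk, fun u v hG hn => ?_⟩, ?_⟩
  · by_contra! hcon
    obtain ⟨K, hK⟩ : ∃ K, K = H ⊔ edge u v := ⟨_, rfl⟩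
    have : K ≤ H := by
      have hHK : H ≤ K := hK ▸ le_sup_left
      refine hH.le_of_ge ⟨hK ▸ sup_le hHG ((edge_le_iff _).2 (Or.inr hG)), fun w => ?_,
        hH0.trans hHK⟩ hHK
      have h1 := degree_le_of_le_sup_edge hK.le w
      have h2 := hHk w
      have h3 := hHk u
      have h4 := hHk v
      split_ifs at h1 with h
      · rcases h with rfl | rfl <;> omega
      · omega
    exact hn (this (hK ▸ Or.inr ((edge_adj u v u v).2 ⟨Or.inl ⟨rfl, rfl⟩, hG.ne⟩)))
  · have hnew : ∀ u v, H.Adj u v → ¬ H₀.Adj u v → H₀.degree u < k := by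
      intro u v huv hn
      refine lt_of_lt_of_le ?_ (hHk u)
      simp only [← card_neighborFinset_eq_degree]
      refine Finset.card_lt_card ⟨fun w hw => ?_, fun h => ?_⟩
      · rw [mem_neighborFinset] at hw ⊢
        exact hH0 hw
      · exact hn ((mem_neighborFinset _ _ _).1 (h ((mem_neighborFinset _ _ _).2 huv)))
    -- Every edge of `H` at `S` is new and leaves `S`, which is independent, so its other end is
    -- deficient in `H₀`. Only one vertex `t` qualifies, and it takes at most `k` edges.
    have hsumS : ∑ v ∈ S, H.degree v ≤ k := by
      have h2 : ∀ v ∈ S, ∀ w, H.Adj v w → w ∉ S ∧ H₀.degree w < k := fun v hv w hvw =>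
        ⟨fun hw => hS v hv w hw (hHG hvw), hnew w v hvw.symm fun h => h0 v hv w h.symm⟩
      by_cases hT : ∃ t, t ∉ S ∧ H₀.degree t < k
      · obtain ⟨t, htS, htk⟩ := hT
        calc ∑ v ∈ S, H.degree v ≤ ∑ v ∈ S, if H.Adj t v then 1 else 0 := by
              refine Finset.sum_le_sum fun v hv => ?_
              have : H.neighborFinset v ⊆ if H.Adj t v then {t} else ∅ := by
                intro w hw
                rw [mem_neighborFinset] at hw
                obtain ⟨h3, h4⟩ := h2 v hv w hw
                obtain rfl := hdef w t h3 htS h4 htk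
                simp [hw.symm]
              have := Finset.card_le_card this
              rw [card_neighborFinset_eq_degree] at this
              split_ifs at this ⊢ <;> simpa using this
          _ = (S.filter (H.Adj t)).card := by rw [Finset.card_filter]
          _ ≤ H.degree t := by
              rw [← card_neighborFinset_eq_degree]
              exact Finset.card_le_card fun w hw => by simpa using (Finset.mem_filter.1 hw).2
          _ ≤ k := hHk t
      · push Not at hT
        rw [Finset.sum_eq_zero]
        · exact Nat.zero_le _
        · intro v hv
          rw [← card_neighborFinset_eq_degree, Finset.card_eq_zero,
            Finset.eq_empty_iff_forall_notMem]
          intro w hw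
          rw [mem_neighborFinset] at hw
          obtain ⟨h3, h4⟩ := h2 v hv w hw
          exact absurd h4 (not_lt.2 (hT w h3))
    have hsumC : ∑ v ∈ Sᶜ, H.degree v ≤ k * Sᶜ.card := by
      simpa [mul_comm] using Finset.sum_le_card_nsmul Sᶜ (fun v => H.degree v) k fun v _ => hHk v
    have htot := sum_degrees_eq_twice_card_edges H
    rw [← Finset.sum_add_sum_compl S] at htot
    have : H.edgeSet.ncard = H.edgeFinset.card := by
      rw [← coe_edgeFinset, Set.ncard_coe_finset]
    rw [this]
    have hc := Finset.card_add_card_compl S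
    rw [← hc, mul_add]
    omega

/-! ### Almost regular subgraphs by edge switching -/

/-- Switching along an alternating path with five edges. -/
theorem exists_switch {k : ℕ} {H : SimpleGraph V} (hk : ∀ a, H.degree a ≤ k) {u v x y z w : V}
    (hnd : [u, v, x, y, z, w].Nodup) (hu : H.degree u < k) (hv : H.degree v < k)
    (hux : ¬ H.Adj u x) (hxy : H.Adj x y) (hyz : ¬ H.Adj y z) (hzw : H.Adj z w)
    (hwv : ¬ H.Adj w v) :
    ∃ K : SimpleGraph V, (∀ a b, K.Adj a b → H.Adj a b ∨ s(a, b) = s(u, x) ∨ s(a, b) = s(y, z) ∨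
      s(a, b) = s(w, v)) ∧ (∀ a, K.degree a ≤ k) ∧ H.edgeSet.ncard < K.edgeSet.ncard := by
  simp only [List.nodup_cons, List.mem_cons, List.not_mem_nil, or_false, not_or] at hnd
  obtain ⟨⟨huv, hux', huy, huz, huw⟩, ⟨hvx, hvy, hvz, hvw⟩, ⟨hxy', hxz, hxw⟩, ⟨hyz', hyw⟩, hzw', -⟩
    := hnd
  obtain ⟨K, hK⟩ : ∃ K : SimpleGraph V, ∀ a b, K.Adj a b ↔
      (H.Adj a b ∧ s(a, b) ≠ s(x, y) ∧ s(a, b) ≠ s(z, w)) ∨ s(a, b) = s(u, x) ∨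
        s(a, b) = s(y, z) ∨ s(a, b) = s(w, v) :=
    ⟨{ Adj := fun a b => (H.Adj a b ∧ s(a, b) ≠ s(x, y) ∧ s(a, b) ≠ s(z, w)) ∨ s(a, b) = s(u, x) ∨
        s(a, b) = s(y, z) ∨ s(a, b) = s(w, v)
       symm := ⟨fun a b h => by rwa [Sym2.eq_swap, H.adj_comm]⟩
       loopless := ⟨fun a h => by
        simp only [SimpleGraph.irrefl, false_and, false_or, Sym2.eq_iff] at h
        grind⟩ }, fun _ _ => Iff.rfl⟩
  refine ⟨K, fun a b h => ((hK a b).1 h).imp_left And.left, fun a => ?_, ?_⟩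
  · have hplus : ∀ b, H.degree a < k → K.neighborFinset a ⊆ insert b (H.neighborFinset a) →
        K.degree a ≤ k := fun b h1 h2 => by
      have := (Finset.card_le_card h2).trans (Finset.card_insert_le _ _)
      rw [card_neighborFinset_eq_degree, card_neighborFinset_eq_degree] at this
      omega
    have hswap : ∀ b c, H.Adj a c → K.neighborFinset a ⊆ insert b ((H.neighborFinset a).erase c) →
        K.degree a ≤ k := fun b c h1 h2 => by
      have := (Finset.card_le_card h2).trans (Finset.card_insert_le _ _)
      rw [Finset.card_erase_add_one ((mem_neighborFinset _ _ _).2 h1),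
        card_neighborFinset_eq_degree, card_neighborFinset_eq_degree] at this
      exact this.trans (hk a)
    have hN : ∀ b, b ∈ K.neighborFinset a ↔ (H.Adj a b ∧ s(a, b) ≠ s(x, y) ∧ s(a, b) ≠ s(z, w)) ∨
        s(a, b) = s(u, x) ∨ s(a, b) = s(y, z) ∨ s(a, b) = s(w, v) := fun b => by
      rw [mem_neighborFinset, hK]
    simp only [ne_eq, Sym2.eq_iff] at hN
    by_cases h1 : a = u
    · subst h1
      exact hplus x hu fun b hb => by
        rw [hN] at hb; rw [Finset.mem_insert, mem_neighborFinset]; grind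
    by_cases h2 : a = v
    · subst h2
      exact hplus w hv fun b hb => by
        rw [hN] at hb; rw [Finset.mem_insert, mem_neighborFinset]; grind
    by_cases h3 : a = x
    · subst h3
      exact hswap u y hxy fun b hb => by
        rw [hN] at hb; rw [Finset.mem_insert, Finset.mem_erase, mem_neighborFinset]; grind
    by_cases h4 : a = y
    · subst h4
      exact hswap z x hxy.symm fun b hb => by
        rw [hN] at hb; rw [Finset.mem_insert, Finset.mem_erase, mem_neighborFinset]; grind
    by_cases h5 : a = z
    · subst h5
      exact hswap y w hzw fun b hb => by
        rw [hN] at hb; rw [Finset.mem_insert, Finset.mem_erase, mem_neighborFinset]; grind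
    by_cases h6 : a = w
    · subst h6
      exact hswap v z hzw.symm fun b hb => by
        rw [hN] at hb; rw [Finset.mem_insert, Finset.mem_erase, mem_neighborFinset]; grind
    have : K.neighborFinset a ⊆ H.neighborFinset a := fun b hb => by
      rw [hN] at hb; rw [mem_neighborFinset]; grind
    have := Finset.card_le_card this
    rw [card_neighborFinset_eq_degree, card_neighborFinset_eq_degree] at this
    exact this.trans (hk a)
  · have hsub : insert s(u, x) (insert s(y, z) (insert s(w, v) (H.edgeSet \ {s(x, y), s(z, w)})))
        ⊆ K.edgeSet := by
      intro e
      induction e with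
      | h a b =>
        simp only [Set.mem_insert_iff, Set.mem_sdiff, mem_edgeSet, Set.mem_singleton_iff, hK]
        tauto
    have h1 := Set.ncard_le_ncard hsub (Set.toFinite _)
    rw [Set.ncard_insert_of_notMem, Set.ncard_insert_of_notMem, Set.ncard_insert_of_notMem] at h1
    · have h2 := Set.le_ncard_sdiff {s(x, y), s(z, w)} H.edgeSet
      have h3 := Set.ncard_insert_le s(x, y) {s(z, w)}
      rw [Set.ncard_singleton] at h3
      omega
    · simp [hwv]
    · simp only [Set.mem_insert_iff, Set.mem_sdiff, mem_edgeSet, hyz, Sym2.eq_iff]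
      grind
    · simp only [Set.mem_insert_iff, Set.mem_sdiff, mem_edgeSet, hux, Sym2.eq_iff]
      grind

theorem ncard_edgeSet_lt_sup_edge {H : SimpleGraph V} {u v : V} (huv : u ≠ v) (h : ¬ H.Adj u v) :
    H.edgeSet.ncard < (H ⊔ edge u v).edgeSet.ncard :=
  Set.ncard_lt_ncard (edgeSet_strict_mono (lt_sup_edge _ _ _ huv h)) (Set.toFinite _)

theorem card_biUnion_neighborFinset_le {k : ℕ} {H : SimpleGraph V} (hk : ∀ a, H.degree a ≤ k)
    (B : Finset V) : (B ∪ B.biUnion fun b => H.neighborFinset b).card ≤ (k + 1) * B.card := by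
  have := Finset.card_biUnion_le_card_mul B (fun b => H.neighborFinset b) k fun b _ => by
    rw [card_neighborFinset_eq_degree]; exact hk b
  have := Finset.card_union_le B (B.biUnion fun b => H.neighborFinset b)
  nlinarith

/-- In a graph of large minimum degree in which large disjoint sets are joined by an edge, a small
set can be avoided by a subgraph of maximum degree `k` that is `k`-regular outside of this set, but
for at most one vertex. -/
theorem exists_almost_regular {k L : ℕ} {G : SimpleGraph V} (S : Finset V) (hk1 : 1 ≤ k)
    (hL : ∀ Y Z : Finset V, Y.card = L → Z.card = L → Disjoint Y Z → ∃ y ∈ Y, ∃ z ∈ Z, G.Adj y z)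
    (hdeg : ∀ v, S.card + (k + 1) ^ 2 * (2 * (k * L) + 2) + k * L ≤ G.degree v) :
    ∃ H ≤ G, (∀ v, H.degree v ≤ k) ∧ (∀ u ∈ S, ∀ v, ¬ H.Adj u v) ∧
      ∀ u v, u ∉ S → v ∉ S → H.degree u < k → H.degree v < k → u = v := by
  obtain ⟨H, ⟨hHG, hk, hHS⟩, hmax⟩ := Set.exists_max_image
    {H : SimpleGraph V | H ≤ G ∧ (∀ v, H.degree v ≤ k) ∧ ∀ u ∈ S, ∀ v, ¬ H.Adj u v}
    (fun H => H.edgeSet.ncard) (Set.toFinite _) ⟨⊥, bot_le, fun v => by simp, fun u _ v => by simp⟩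
  refine ⟨H, hHG, hk, hHS, fun u v huS hvS hu hv => ?_⟩
  by_contra huv
  -- If `x` had no `H`-neighbour, the edge `ax` could be added to `H`, against the maximal number of
  -- edges.
  have hfull : ∀ a x, a ∉ S → x ∉ S → H.degree a < k → G.Adj a x → ¬ H.Adj a x →
      ∃ y, H.Adj x y := by
    intro a x haS hxS ha hG hn
    by_contra! hx
    have hx0 : H.degree x = 0 := by
      rw [← card_neighborFinset_eq_degree, Finset.card_eq_zero,
        Finset.eq_empty_iff_forall_notMem]
      intro y
      rw [mem_neighborFinset]
      exact hx y
    have hlt := ncard_edgeSet_lt_sup_edge hG.ne hn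
    obtain ⟨K, hK⟩ : ∃ K, K = H ⊔ edge a x := ⟨_, rfl⟩
    rw [← hK] at hlt
    refine absurd hlt (not_lt.2 (hmax K ⟨hK ▸ sup_le hHG ((edge_le_iff _).2 (Or.inr hG)), ?_, ?_⟩))
    · intro c
      have h1 := degree_le_of_le_sup_edge hK.le c
      have h2 := hk c
      split_ifs at h1 with h
      · rcases h with rfl | rfl <;> omega
      · omega
    · intro c hc d hcd
      rw [hK, sup_adj, edge_adj] at hcd
      rcases hcd with h | ⟨⟨rfl, rfl⟩ | ⟨rfl, rfl⟩, -⟩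
      · exact hHS _ hc _ h
      · exact haS hc
      · exact hxS hc
  -- many vertices near a deficient vertex that avoid a given set
  have hpick : ∀ a, a ∉ S → H.degree a < k → ∀ B : Finset V,
      B.card ≤ (k + 1) ^ 2 * (2 * (k * L) + 2) → (∀ b, H.Adj a b → b ∈ B) →
      ∃ X : Finset V, ∃ f : V → V, X.card = k * L ∧ L ≤ (X.image f).card ∧
        ∀ x ∈ X, x ∉ S ∧ x ∉ B ∧ G.Adj a x ∧ ¬ H.Adj a x ∧ H.Adj x (f x) := by
    intro a haS ha B hB hBa
    have h1 := hdeg a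
    have h2 := Finset.le_card_sdiff (S ∪ B) (G.neighborFinset a)
    have h3 := Finset.card_union_le S B
    rw [card_neighborFinset_eq_degree] at h2
    obtain ⟨X, hX, hXc⟩ := Finset.exists_subset_card_eq
      (show k * L ≤ (G.neighborFinset a \ (S ∪ B)).card by omega)
    have hX' : ∀ x ∈ X, x ∉ S ∧ x ∉ B ∧ G.Adj a x ∧ ¬ H.Adj a x := by
      intro x hx
      have := hX hx
      simp only [Finset.mem_sdiff, mem_neighborFinset, Finset.mem_union, not_or] at this
      exact ⟨this.2.1, this.2.2, this.1, fun h => this.2.2 (hBa x h)⟩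
    have : ∀ x, ∃ y, x ∈ X → H.Adj x y := fun x => by
      by_cases hx : x ∈ X
      · obtain ⟨h4, -, h5, h6⟩ := hX' x hx
        obtain ⟨y, hy⟩ := hfull a x haS h4 ha h5 h6
        exact ⟨y, fun _ => hy⟩
      · exact ⟨x, fun h => absurd h hx⟩
    choose f hf using this
    refine ⟨X, f, hXc, ?_, fun x hx => ?_⟩
    · have := Finset.card_le_mul_card_image (f := f) X k fun b _ => by
        refine (Finset.card_le_card (t := H.neighborFinset b) fun x hx => ?_).trans
          ((card_neighborFinset_eq_degree H b).le.trans (hk b))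
        rw [Finset.mem_filter] at hx
        rw [mem_neighborFinset, ← hx.2]
        exact (hf x hx.1).symm
      rw [hXc] at this
      exact Nat.le_of_mul_le_mul_left this hk1
    · obtain ⟨h4, h5, h6, h7⟩ := hX' x hx
      exact ⟨h4, h5, h6, h7, hf x hx⟩
  have hup : ∀ B : Finset V, ∃ B' : Finset V, B'.card ≤ (k + 1) * B.card ∧ B ⊆ B' ∧
      ∀ b ∈ B, ∀ c, H.Adj b c → c ∈ B' := fun B =>
    ⟨_, card_biUnion_neighborFinset_le hk B, Finset.subset_union_left, fun b hb c hbc =>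
      Finset.mem_union_right _ (Finset.mem_biUnion.2 ⟨b, hb, (mem_neighborFinset _ _ _).2 hbc⟩)⟩
  obtain ⟨A, hAc, hA, hA'⟩ := hup {u, v}
  have huvc : ({u, v} : Finset V).card ≤ 2 := Finset.card_le_two
  obtain ⟨X, f, hXc, hfX, hX⟩ := hpick u huS hu A (by nlinarith [Nat.zero_le (k * L)])
    (hA' u (by simp))
  set B₀ : Finset V := {u, v} ∪ (X ∪ X.image f) with hB₀
  have hB₀c : B₀.card ≤ 2 * (k * L) + 2 := by
    have h1 : B₀.card ≤ _ := Finset.card_union_le {u, v} (X ∪ X.image f)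
    have h2 := Finset.card_union_le X (X.image f)
    have h3 := Finset.card_image_le (s := X) (f := f)
    omega
  -- `B₁` and `B₂` are successive closed `H`-neighbourhoods of `B₀`. Choosing `W` outside `B₂` keeps
  -- both `w` and `g w` outside `B₁`, so they are new vertices and `g w` is not `H`-adjacent to any
  -- `f x`. This accounts for the factor `(k + 1) ^ 2` in the degree hypothesis.
  obtain ⟨B₁, hB₁c, hB₁, hB₁'⟩ := hup B₀
  obtain ⟨B₂, hB₂c, hB₂, hB₂'⟩ := hup B₁
  obtain ⟨W, g, hWc, hgW, hW⟩ := hpick v hvS hv B₂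
    (by
      calc B₂.card ≤ (k + 1) * ((k + 1) * (2 * (k * L) + 2)) :=
            hB₂c.trans (Nat.mul_le_mul_left _ (hB₁c.trans (Nat.mul_le_mul_left _ hB₀c)))
        _ = _ := by ring)
    (fun b hb => hB₂ (hB₁' v (by simp [hB₀]) b hb))
  obtain ⟨Y, hY, hYc⟩ := Finset.exists_subset_card_eq hfX
  obtain ⟨Z, hZ, hZc⟩ := Finset.exists_subset_card_eq hgW
  -- neither `w` nor `g w` is close to the vertices used so far
  have hWB : ∀ w ∈ W, w ∉ B₁ ∧ g w ∉ B₁ := fun w hw =>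
    ⟨fun h => (hW w hw).2.1 (hB₂ h),
      fun h => (hW w hw).2.1 (hB₂' _ h _ (hW w hw).2.2.2.2.symm)⟩
  have hYZ : Disjoint Y Z := by
    rw [Finset.disjoint_left]
    intro c hc hc'
    obtain ⟨x, hx, rfl⟩ := Finset.mem_image.1 (hY hc)
    obtain ⟨w, hw, hwx⟩ := Finset.mem_image.1 (hZ hc')
    refine (hWB w hw).2 (hB₁ ?_)
    rw [hwx, hB₀]
    exact Finset.mem_union_right _ (Finset.mem_union_right _ (Finset.mem_image_of_mem f hx))
  obtain ⟨y, hy, z, hz, hyz⟩ := hL Y Z hYc hZc hYZ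
  obtain ⟨x, hx, rfl⟩ := Finset.mem_image.1 (hY hy)
  obtain ⟨w, hw, rfl⟩ := Finset.mem_image.1 (hZ hz)
  obtain ⟨hxS, hxA, hGux, hHux, hxy⟩ := hX x hx
  obtain ⟨hwS, hwB, hGvw, hHvw, hwz⟩ := hW w hw
  obtain ⟨hw1, hz1⟩ := hWB w hw
  have hyA : ∀ c ∈ ({u, v} : Finset V), f x ≠ c := by
    rintro c hc rfl
    exact hxA (hA' _ hc _ hxy.symm)
  have hB : ∀ c ∈ B₀, w ≠ c ∧ g w ≠ c := fun c hc =>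
    ⟨fun h => hw1 (hB₁ (h ▸ hc)), fun h => hz1 (hB₁ (h ▸ hc))⟩
  have huB : u ∈ B₀ := by simp [hB₀]
  have hvB : v ∈ B₀ := by simp [hB₀]
  have hxB : x ∈ B₀ := by simp [hB₀, hx]
  have hyB : f x ∈ B₀ :=
    Finset.mem_union_right _ (Finset.mem_union_right _ (Finset.mem_image_of_mem f hx))
  have hvx : v ≠ x := fun h => hxA (hA (by simp [h]))
  have hnyz : ¬ H.Adj (f x) (g w) := fun h => hz1 (hB₁' _ hyB _ h)
  -- The alternating path is `u, x, f x, g w, w, v`; its middle edge comes from `hL`.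
  obtain ⟨K, hKadj, hKk, hKc⟩ := exists_switch hk (u := u) (v := v) (x := x) (y := f x)
    (z := g w) (w := w) (by
      simp only [List.nodup_cons, List.mem_cons, List.not_mem_nil, or_false, not_or]
      refine ⟨⟨huv, hGux.ne, (hyA u (by simp)).symm, (hB u huB).2.symm, (hB u huB).1.symm⟩,
        ⟨hvx, (hyA v (by simp)).symm, (hB v hvB).2.symm, (hB v hvB).1.symm⟩,
        ⟨hxy.ne, (hB x hxB).2.symm, (hB x hxB).1.symm⟩, ⟨(hB _ hyB).2.symm, (hB _ hyB).1.symm⟩,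
        hwz.ne', not_false, List.nodup_nil⟩)
    hu hv hHux hxy hnyz hwz.symm (fun h => hHvw h.symm)
  have hyS : f x ∉ S := fun h => hHS _ h _ hxy.symm
  have hzS : g w ∉ S := fun h => hHS _ h _ hwz.symm
  refine absurd hKc (not_lt.2 (hmax K ⟨fun a b hab => ?_, hKk, fun a ha b hab => ?_⟩))
  · rcases hKadj a b hab with h | h | h | h
    · exact hHG h
    · exact (G.mem_edgeSet).1 (h ▸ (G.mem_edgeSet).2 hGux)
    · exact (G.mem_edgeSet).1 (h ▸ (G.mem_edgeSet).2 hyz)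
    · exact (G.mem_edgeSet).1 (h ▸ (G.mem_edgeSet).2 hGvw.symm)
  · have := hKadj a b hab
    simp only [Sym2.eq_iff] at this
    have := hHS a ha b
    grind

end SimpleGraph

/-! ### Probability estimates for the random graph -/

namespace SimpleGraph

open scoped Classical
open MeasureTheory ProbabilityTheory

/-- The unordered pairs of distinct elements of a finite set. -/
noncomputable def pairs {V : Type*} (A : Finset V) : Finset (Sym2 V) :=
  A.offDiag.image Sym2.mk.uncurry

section pairs

variable {V : Type*} {A B : Finset V}

theorem mk_mem_pairs {a b : V} : s(a, b) ∈ pairs A ↔ a ∈ A ∧ b ∈ A ∧ a ≠ b := by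
  simp only [pairs, Finset.mem_image, Finset.mem_offDiag, Prod.exists, Function.uncurry_apply_pair,
    Sym2.eq_iff]
  constructor
  · rintro ⟨x, y, ⟨hx, hy, hxy⟩, ⟨rfl, rfl⟩ | ⟨rfl, rfl⟩⟩
    · exact ⟨hx, hy, hxy⟩
    · exact ⟨hy, hx, hxy.symm⟩
  · rintro h
    exact ⟨a, b, h, Or.inl ⟨rfl, rfl⟩⟩

theorem card_pairs (A : Finset V) : (pairs A).card = A.card.choose 2 :=
  Sym2.card_image_offDiag A

theorem not_isDiag_of_mem_pairs {e : Sym2 V} (he : e ∈ pairs A) : ¬ e.IsDiag := by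
  induction e with
  | h a b => simpa using (mk_mem_pairs.1 he).2.2

theorem pairs_inter (A B : Finset V) : pairs A ∩ pairs B = pairs (A ∩ B) := by
  ext e
  induction e with
  | h a b =>
    simp only [Finset.mem_inter, mk_mem_pairs]
    tauto

theorem card_pairs_union (A B : Finset V) :
    (pairs A ∪ pairs B).card + (A ∩ B).card.choose 2 = A.card.choose 2 + B.card.choose 2 := by
  rw [← card_pairs, ← card_pairs, ← card_pairs, ← pairs_inter, Finset.card_union_add_card_inter]

end pairs

variable {V : Type*} [Fintype V]

/-- With finitely many graphs, this makes every event measurable. -/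
instance : MeasurableSingletonClass (SimpleGraph V) where
  measurableSet_singleton G := by
    have : ({G} : Set (SimpleGraph V)) = edgeSet ⁻¹' {G.edgeSet} := by
      ext H
      simp
    rw [this]
    exact measurable_edgeSet (measurableSet_singleton _)

/-- The probability that the random graph contains no edge from a given set of pairs. -/
theorem binomialRandom_real_forall_notMem (p : unitInterval) {Q : Finset (Sym2 V)}
    (hQ : ∀ e ∈ Q, ¬ e.IsDiag) :
    (binomialRandom V p).real {G | ∀ e ∈ Q, e ∉ G.edgeSet} = (1 - (p : ℝ)) ^ Q.card := by
  rw [measureReal_def, binomialRandom_eq_map,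
    Measure.map_apply measurable_fromEdgeSet (Set.toFinite _).measurableSet, setBernoulli_apply']
  have : (fun P : Sym2 V → Prop => {i | P i}) ⁻¹'
      (fromEdgeSet ⁻¹' {G : SimpleGraph V | ∀ e ∈ Q, e ∉ G.edgeSet}) =
      Set.pi (Q : Set (Sym2 V)) fun _ => {False} := by
    ext P
    simp only [Set.mem_preimage, Set.mem_ofPred_eq, Set.mem_pi, Finset.mem_coe,
      edgeSet_fromEdgeSet, Set.mem_singleton_iff, eq_iff_iff, iff_false]
    refine forall₂_congr fun e he => ?_
    simp [hQ e he]
  rw [this, Measure.infinitePi_pi _ fun _ _ => measurableSet_singleton _]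
  have : ∀ e ∈ Q, ((unitInterval.toNNReal p • Measure.dirac (e ∈ (Sym2.diagSetᶜ : Set (Sym2 V))) +
      unitInterval.toNNReal (unitInterval.symm p) • Measure.dirac False : Measure Prop)) {False} =
        unitInterval.toNNReal (unitInterval.symm p) := by
    intro e he
    simp [hQ e he]
  rw [Finset.prod_congr rfl this, Finset.prod_const, ENNReal.toReal_pow]
  simp

/-- The union bound over families of sets of pairs that contain no edge. -/
theorem binomialRandom_real_le_card_mul (p : unitInterval) {ι : Type*} (I : Finset ι)
    (Q : ι → Finset (Sym2 V)) (c : ℕ) (hQ : ∀ i ∈ I, ∀ e ∈ Q i, ¬ e.IsDiag)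
    (hc : ∀ i ∈ I, (Q i).card = c) {E : Set (SimpleGraph V)}
    (hE : ∀ G ∈ E, ∃ i ∈ I, ∀ e ∈ Q i, e ∉ G.edgeSet) :
    (binomialRandom V p).real E ≤ I.card * (1 - (p : ℝ)) ^ c := by
  calc (binomialRandom V p).real E
      ≤ (binomialRandom V p).real (⋃ i ∈ I, {G | ∀ e ∈ Q i, e ∉ G.edgeSet}) := by
        refine measureReal_mono (fun G hG => ?_) (measure_ne_top _ _)
        obtain ⟨i, hi, h⟩ := hE G hG
        exact Set.mem_biUnion hi h
    _ ≤ ∑ i ∈ I, (binomialRandom V p).real {G | ∀ e ∈ Q i, e ∉ G.edgeSet} :=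
        measureReal_biUnion_finset_le _ _
    _ = ∑ i ∈ I, (1 - (p : ℝ)) ^ c := Finset.sum_congr rfl fun i hi => by
        rw [binomialRandom_real_forall_notMem p (hQ i hi), hc i hi]
    _ = _ := by simp

/-- Large disjoint sets are joined by an edge. -/
theorem binomialRandom_real_exists_no_edges_between_le (p : unitInterval) (L : ℕ) :
    (binomialRandom V p).real {G | ¬ ∀ Y Z : Finset V, Y.card = L → Z.card = L → Disjoint Y Z →
      ∃ y ∈ Y, ∃ z ∈ Z, G.Adj y z} ≤ (Fintype.card V ^ 2 * (1 - (p : ℝ)) ^ L) ^ L := by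
  have hp : 0 ≤ 1 - (p : ℝ) := sub_nonneg.2 p.2.2
  set I : Finset (Finset V × Finset V) := (Finset.univ.powersetCard L ×ˢ
    Finset.univ.powersetCard L).filter fun i => Disjoint i.1 i.2 with hI
  have hIc : I.card ≤ (Fintype.card V ^ 2) ^ L := by
    refine (Finset.card_filter_le _ _).trans ?_
    rw [Finset.card_product, Finset.card_powersetCard, Finset.card_univ, ← pow_mul, two_mul,
      pow_add]
    exact Nat.mul_le_mul (Nat.choose_le_pow _ _) (Nat.choose_le_pow _ _)
  refine (binomialRandom_real_le_card_mul p I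
    (fun i => (i.1 ×ˢ i.2).image Sym2.mk.uncurry) (L * L) ?_ ?_ ?_).trans ?_
  · rintro ⟨Y, Z⟩ hi e he
    simp only [hI, Finset.mem_filter] at hi
    obtain ⟨⟨y, z⟩, hyz, rfl⟩ := Finset.mem_image.1 he
    rw [Finset.mem_product] at hyz
    simpa using fun h : y = z => Finset.disjoint_left.1 hi.2 hyz.1 (h ▸ hyz.2)
  · rintro ⟨Y, Z⟩ hi
    simp only [hI, Finset.mem_filter, Finset.mem_product, Finset.mem_powersetCard_univ] at hi
    rw [Finset.card_image_of_injOn, Finset.card_product, hi.1.1, hi.1.2]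
    rintro ⟨y, z⟩ h ⟨y', z'⟩ h' heq
    simp only [Finset.coe_product, Set.mem_prod, Finset.mem_coe] at h h'
    simp only [Function.uncurry_apply_pair, Sym2.eq_iff] at heq
    rcases heq with ⟨rfl, rfl⟩ | ⟨rfl, rfl⟩
    · rfl
    · exact absurd h'.2 (Finset.disjoint_left.1 hi.2 h.1)
  · intro G hG
    simp only [Set.mem_ofPred_eq, not_forall] at hG
    obtain ⟨Y, Z, hY, hZ, hd, hn⟩ := hG
    refine ⟨(Y, Z), by simp [hI, hY, hZ, hd], fun e he h => hn ?_⟩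
    obtain ⟨⟨y, z⟩, hyz, rfl⟩ := Finset.mem_image.1 he
    rw [Finset.mem_product] at hyz
    exact ⟨y, hyz.1, z, hyz.2, h⟩
  · rw [mul_pow, ← pow_mul (1 - (p : ℝ))]
    gcongr
    exact_mod_cast hIc

/-- A lower bound on the minimum degree. -/
theorem binomialRandom_real_exists_degree_lt_le (p : unitInterval) {D : ℕ}
    (hD : D ≤ Fintype.card V) :
    (binomialRandom V p).real {G | ¬ ∀ v, D ≤ G.degree v} ≤
      (Fintype.card V : ℝ) ^ (D + 1) * (1 - (p : ℝ)) ^ (Fintype.card V - D) := by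
  have hp : 0 ≤ 1 - (p : ℝ) := sub_nonneg.2 p.2.2
  set N := Fintype.card V with hN
  set I : Finset (V × Finset V) := (Finset.univ ×ˢ Finset.univ.powersetCard (N - D)).filter
    fun i => i.1 ∉ i.2 with hI
  have hIc : I.card ≤ N ^ (D + 1) := by
    refine (Finset.card_filter_le _ _).trans ?_
    rw [Finset.card_product, Finset.card_powersetCard, Finset.card_univ, ← hN, pow_succ',
      Nat.choose_symm hD]
    exact Nat.mul_le_mul le_rfl (Nat.choose_le_pow _ _)
  refine (binomialRandom_real_le_card_mul p I
    (fun i => i.2.image fun w => s(i.1, w)) (N - D) ?_ ?_ ?_).trans ?_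
  · rintro ⟨v, W⟩ hi e he
    simp only [hI, Finset.mem_filter] at hi
    obtain ⟨w, hw, rfl⟩ := Finset.mem_image.1 he
    simpa using fun h : v = w => hi.2 (h ▸ hw)
  · rintro ⟨v, W⟩ hi
    simp only [hI, Finset.mem_filter, Finset.mem_product, Finset.mem_powersetCard_univ] at hi
    rw [Finset.card_image_of_injective, hi.1.2]
    intro w w' h
    simp only [Sym2.eq_iff, true_and] at h
    rcases h with h | ⟨rfl, rfl⟩
    · exact h
    · rfl
  · intro G hG
    simp only [Set.mem_ofPred_eq, not_forall, not_le] at hG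
    obtain ⟨v, hv⟩ := hG
    -- Degree at most `D - 1` leaves at least `N - 1 - (D - 1)` non-neighbours other than `v`.
    have hc : N - D ≤ (Finset.univ \ insert v (G.neighborFinset v)).card := by
      have h1 := Finset.le_card_sdiff (insert v (G.neighborFinset v)) Finset.univ
      have h2 := Finset.card_insert_le v (G.neighborFinset v)
      rw [card_neighborFinset_eq_degree] at h2
      rw [Finset.card_univ, ← hN] at h1
      omega
    obtain ⟨W, hW, hWc⟩ := Finset.exists_subset_card_eq hc
    have hW' : ∀ w ∈ W, w ≠ v ∧ ¬ G.Adj v w := fun w hw => by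
      simpa using hW hw
    refine ⟨(v, W), ?_, fun e he h => ?_⟩
    · simp only [hI, Finset.mem_filter, Finset.mem_product, Finset.mem_univ, true_and,
        Finset.mem_powersetCard_univ, hWc]
      exact fun h => (hW' v h).1 rfl
    · obtain ⟨w, hw, rfl⟩ := Finset.mem_image.1 he
      exact (hW' w hw).2 h
  · gcongr
    exact_mod_cast hIc

/-- Sets of logarithmic size span a vertex of large degree. -/
theorem binomialRandom_real_exists_sparse_le (p : unitInterval) {k s : ℕ}
    (hs : s * k ≤ s.choose 2) :
    (binomialRandom V p).real {G | ¬ ∀ A : Finset V, A.card = s →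
      ∃ v ∈ A, k ≤ (A.filter (G.Adj v)).card} ≤
      (Fintype.card V : ℝ) ^ s * ((s : ℝ) ^ 2) ^ (s * k) *
        (1 - (p : ℝ)) ^ (s.choose 2 - s * k) := by
  have hp : 0 ≤ 1 - (p : ℝ) := sub_nonneg.2 p.2.2
  -- The second component is a set of exactly `s * k` pairs containing all edges inside `A`, padded
  -- if necessary so that the number of forced non-edges is the same for every index.
  set I : Finset (Σ _ : Finset V, Finset (Sym2 V)) :=
    (Finset.univ.powersetCard s).sigma fun A => (pairs A).powersetCard (s * k) with hI
  have hIc : I.card ≤ Fintype.card V ^ s * (s ^ 2) ^ (s * k) := by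
    rw [hI, Finset.card_sigma]
    calc ∑ A ∈ Finset.univ.powersetCard s, ((pairs A).powersetCard (s * k)).card
        ≤ ∑ A ∈ (Finset.univ : Finset V).powersetCard s, (s ^ 2) ^ (s * k) := by
          refine Finset.sum_le_sum fun A hA => ?_
          rw [Finset.card_powersetCard, card_pairs, (Finset.mem_powersetCard.1 hA).2]
          exact (Nat.choose_le_pow _ _).trans (Nat.pow_le_pow_left (Nat.choose_le_pow _ _) _)
      _ ≤ _ := by
          rw [Finset.sum_const, smul_eq_mul, Finset.card_powersetCard, Finset.card_univ]
          exact Nat.mul_le_mul (Nat.choose_le_pow _ _) le_rfl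
  refine (binomialRandom_real_le_card_mul p I
    (fun i => pairs i.1 \ i.2) (s.choose 2 - s * k) ?_ ?_ ?_).trans ?_
  · rintro ⟨A, F⟩ - e he
    exact not_isDiag_of_mem_pairs (Finset.mem_sdiff.1 he).1
  · rintro ⟨A, F⟩ hi
    simp only [hI, Finset.mem_sigma, Finset.mem_powersetCard] at hi
    rw [Finset.card_sdiff_of_subset hi.2.1, card_pairs, hi.1.2, hi.2.2]
  · intro G hG
    simp only [Set.mem_ofPred_eq, not_forall, not_exists, not_and, not_le] at hG
    obtain ⟨A, hA, hdeg⟩ := hG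
    have hF : ((pairs A).filter (· ∈ G.edgeSet)).card ≤ s * k := by
      rw [← hA]
      refine (Finset.card_le_card (t := A.biUnion fun v => (A.filter (G.Adj v)).image
        fun w => s(v, w)) fun e he => ?_).trans (Finset.card_biUnion_le_card_mul _ _ _ fun v hv =>
          Finset.card_image_le.trans (hdeg v hv).le)
      induction e with
      | h a b =>
        rw [Finset.mem_filter, mk_mem_pairs] at he
        exact Finset.mem_biUnion.2 ⟨a, he.1.1, Finset.mem_image.2
          ⟨b, Finset.mem_filter.2 ⟨he.1.2.1, he.2⟩, rfl⟩⟩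
    obtain ⟨F, hF1, hF2, hFc⟩ := Finset.exists_subsuperset_card_eq (Finset.filter_subset _ _) hF
      (by rwa [card_pairs, hA])
    refine ⟨⟨A, F⟩, ?_, fun e he h => ?_⟩
    · simp only [hI, Finset.mem_sigma, Finset.mem_powersetCard]
      exact ⟨⟨Finset.subset_univ _, hA⟩, hF2, hFc⟩
    · rw [Finset.mem_sdiff] at he
      exact he.2 (hF1 (Finset.mem_filter.2 ⟨he.1, h⟩))
  · gcongr
    exact_mod_cast hIc

/-- The second moment method for families of sets of pairs that contain no edge. -/
theorem binomialRandom_real_forall_exists_mem_le (p : unitInterval) (hp1 : p < 1) {ι : Type*}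
    {I : Finset ι} (hI : I.Nonempty) (Q : ι → Finset (Sym2 V)) (c : ℕ) (δ : ℝ)
    (hQ : ∀ i ∈ I, ∀ e ∈ Q i, ¬ e.IsDiag) (hc : ∀ i ∈ I, (Q i).card = c)
    (h2 : ∀ i ∈ I, ∑ j ∈ I, (1 - (p : ℝ)) ^ (Q i ∪ Q j).card ≤
      I.card * ((1 - (p : ℝ)) ^ c) ^ 2 * (1 + δ)) :
    (binomialRandom V p).real {G | ¬ ∃ i ∈ I, ∀ e ∈ Q i, e ∉ G.edgeSet} ≤ δ := by
  have hp : 0 < 1 - (p : ℝ) := sub_pos.2 hp1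
  set μ := binomialRandom V p
  set E : Finset (Sym2 V) → Set (SimpleGraph V) := fun Q => {G | ∀ e ∈ Q, e ∉ G.edgeSet} with hE
  have hmeas : ∀ T : Set (SimpleGraph V), MeasurableSet T := fun T => (Set.toFinite T).measurableSet
  have hint : ∀ f : SimpleGraph V → ℝ, Integrable f μ := fun f => Integrable.of_finite
  set X : SimpleGraph V → ℝ := fun G => ∑ i ∈ I, (E (Q i)).indicator 1 G with hX
  set m : ℝ := I.card * (1 - (p : ℝ)) ^ c with hm
  have hmpos : 0 < m := by
    have : (0 : ℝ) < I.card := by exact_mod_cast hI.card_pos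
    positivity
  have hEX : ∫ G, X G ∂μ = m := by
    rw [hX, integral_finsetSum _ fun i _ => hint _]
    rw [Finset.sum_congr rfl fun i hi => show ∫ G, (E (Q i)).indicator 1 G ∂μ =
      (1 - (p : ℝ)) ^ c by
        rw [integral_indicator_one (hmeas _), hE]
        rw [binomialRandom_real_forall_notMem p (hQ i hi), hc i hi]]
    simp [hm]
  have hEX2 : ∫ G, X G ^ 2 ∂μ ≤ m ^ 2 * (1 + δ) := by
    have h3 : ∀ G, X G ^ 2 = ∑ i ∈ I, ∑ j ∈ I, (E (Q i ∪ Q j)).indicator 1 G := by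
      intro G
      rw [hX, sq, Finset.sum_mul_sum]
      refine Finset.sum_congr rfl fun i _ => Finset.sum_congr rfl fun j _ => ?_
      have : E (Q i ∪ Q j) = E (Q i) ∩ E (Q j) := by
        ext G
        simp only [hE, Set.mem_ofPred_eq, Finset.mem_union, Set.mem_inter_iff]
        grind
      rw [this, Set.inter_indicator_one, Pi.mul_apply]
    simp_rw [h3]
    rw [integral_finsetSum _ fun i _ => hint _]
    calc ∑ i ∈ I, ∫ G, ∑ j ∈ I, (E (Q i ∪ Q j)).indicator 1 G ∂μ
        = ∑ i ∈ I, ∑ j ∈ I, (1 - (p : ℝ)) ^ (Q i ∪ Q j).card := by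
          refine Finset.sum_congr rfl fun i hi => ?_
          rw [integral_finsetSum _ fun i _ => hint _]
          refine Finset.sum_congr rfl fun j hj => ?_
          rw [integral_indicator_one (hmeas _), hE]
          refine binomialRandom_real_forall_notMem p fun e he => ?_
          rcases Finset.mem_union.1 he with h | h
          · exact hQ i hi e h
          · exact hQ j hj e h
      _ ≤ ∑ i ∈ I, I.card * ((1 - (p : ℝ)) ^ c) ^ 2 * (1 + δ) := Finset.sum_le_sum h2
      _ = m ^ 2 * (1 + δ) := by
          rw [Finset.sum_const, nsmul_eq_mul, hm]
          ring
  have hvar : ∫ G, (X G - m) ^ 2 ∂μ ≤ m ^ 2 * δ := by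
    have h4 : ∀ G, (X G - m) ^ 2 = X G ^ 2 - (2 * m) * X G + m ^ 2 := fun G => by ring
    simp_rw [h4]
    rw [integral_add (hint _) (hint _), integral_sub (hint _) (hint _), integral_const_mul, hEX]
    simp only [integral_const, probReal_univ, one_smul]
    linarith
  -- Chebyshev's inequality at deviation `m`, since `X = 0` means `(X - m) ^ 2 = m ^ 2`.
  have hmarkov := mul_meas_ge_le_integral_of_nonneg (μ := μ) (f := fun G => (X G - m) ^ 2)
    (Filter.Eventually.of_forall fun G => sq_nonneg _) (hint _) (m ^ 2)
  have hle : μ.real {G | ¬ ∃ i ∈ I, ∀ e ∈ Q i, e ∉ G.edgeSet} ≤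
      μ.real {G | m ^ 2 ≤ (X G - m) ^ 2} := by
    refine measureReal_mono fun G hG => ?_
    have : X G = 0 := by
      refine Finset.sum_eq_zero fun i hi => Set.indicator_of_notMem
        (show G ∉ E (Q i) from fun h => hG ⟨i, hi, h⟩) _
    simp [this]
  have := hle.trans (le_of_mul_le_mul_left (hmarkov.trans hvar) (by positivity))
  exact this

/-- A large independent set exists with high probability: the second moment method for the
transversals of `s` disjoint sets of `m` vertices. -/
theorem binomialRandom_real_no_independent_le (p : unitInterval) (hp1 : p < 1) {s m : ℕ}
    (hm : 0 < m) (hsm : s * m ≤ Fintype.card V) :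
    (binomialRandom V p).real {G | ¬ ∃ A : Finset V, A.card = s ∧
      ∀ u ∈ A, ∀ v ∈ A, ¬ G.Adj u v} ≤
      (1 + √(1 / (1 - (p : ℝ))) ^ (s - 1) / m) ^ s - 1 := by
  have hp : 0 < 1 - (p : ℝ) := sub_pos.2 hp1
  set q : ℝ := 1 - (p : ℝ) with hq
  have hq1 : q ≤ 1 := by linarith [p.2.1]
  -- Two transversals meeting in `i` vertices share `i.choose 2 ≤ (s - 1) * i / 2` pairs, so their
  -- correlation is at most `β ^ ((s - 1) * i)` with `β = q ^ (-1/2)`. This bound is a product over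
  -- coordinates, so the sum over all transversals factors.
  set β : ℝ := √(1 / q) with hβ
  have hβ2 : β ^ 2 * q = 1 := by
    rw [hβ, Real.sq_sqrt (by positivity)]
    field_simp
  have hβ1 : 1 ≤ β := by
    rw [hβ, Real.one_le_sqrt]
    exact one_le_one_div hp hq1
  obtain ⟨φ⟩ : Nonempty (Fin s × Fin m ↪ V) :=
    Function.Embedding.nonempty_of_card_le (by simpa using hsm)
  set A : (Fin s → Fin m) → Finset V := fun f => Finset.univ.image fun j => φ (j, f j) with hA
  have hinj : ∀ f : Fin s → Fin m, Function.Injective fun j => φ (j, f j) := fun f i j h =>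
    congrArg Prod.fst (φ.injective h)
  have hAc : ∀ f, (A f).card = s := fun f => by
    rw [hA, Finset.card_image_of_injective _ (hinj f)]
    simp
  have hAi : ∀ f g, A f ∩ A g = (Finset.univ.filter fun j => f j = g j).image
      fun j => φ (j, f j) := by
    intro f g
    ext v
    simp only [hA, Finset.mem_inter, Finset.mem_image, Finset.mem_univ, true_and,
      Finset.mem_filter]
    constructor
    · rintro ⟨⟨i, rfl⟩, j, hj⟩
      have := φ.injective hj
      simp only [Prod.mk.injEq] at this
      obtain ⟨rfl, h⟩ := this
      exact ⟨j, h.symm, rfl⟩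
    · rintro ⟨i, hi, rfl⟩
      exact ⟨⟨i, rfl⟩, i, by rw [hi]⟩
  have : Nonempty (Fin m) := ⟨⟨0, hm⟩⟩
  have key := binomialRandom_real_forall_exists_mem_le (V := V) p hp1 (I := Finset.univ)
    Finset.univ_nonempty (fun f => pairs (A f)) (s.choose 2) ((1 + β ^ (s - 1) / m) ^ s - 1)
    (fun f _ e he => not_isDiag_of_mem_pairs he) (fun f _ => by rw [card_pairs, hAc]) ?_
  · refine (measureReal_mono fun G hG => ?_).trans key
    rintro ⟨f, -, hf⟩
    refine hG ⟨A f, hAc f, fun u hu v hv huv => hf s(u, v) ?_ huv⟩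
    exact mk_mem_pairs.2 ⟨hu, hv, huv.ne⟩
  · intro f _
    have hterm : ∀ g, q ^ (pairs (A f) ∪ pairs (A g)).card ≤
        (q ^ s.choose 2) ^ 2 * ∏ j, if f j = g j then β ^ (s - 1) else 1 := by
      intro g
      set i := (Finset.univ.filter fun j => f j = g j).card with hi
      have hi' : (A f ∩ A g).card = i := by
        rw [hAi, Finset.card_image_of_injective _ (hinj f)]
      have his : i ≤ s := by simpa using Finset.card_filter_le Finset.univ fun j => f j = g j
      have h1 := card_pairs_union (A f) (A g)
      rw [hi', hAc, hAc] at h1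
      have h3 : 2 * i.choose 2 ≤ (s - 1) * i := by
        rw [Nat.choose_two_right, Nat.mul_div_cancel' (Nat.even_mul_pred_self i).two_dvd, mul_comm]
        exact Nat.mul_le_mul_right _ (Nat.sub_le_sub_right his 1)
      rw [Finset.prod_ite, Finset.prod_const, Finset.prod_const_one, mul_one, ← hi, ← pow_mul,
        ← pow_mul, mul_two, ← h1, pow_add q, mul_assoc]
      refine le_mul_of_one_le_right (by positivity) ?_
      calc (1 : ℝ) = (β ^ 2 * q) ^ i.choose 2 := by rw [hβ2, one_pow]
        _ = q ^ i.choose 2 * β ^ (2 * i.choose 2) := by rw [mul_pow, ← pow_mul, mul_comm]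
        _ ≤ q ^ i.choose 2 * β ^ ((s - 1) * i) := by gcongr
    have hm' : (m : ℝ) ≠ 0 := by positivity
    calc ∑ g, q ^ (pairs (A f) ∪ pairs (A g)).card
        ≤ ∑ g : Fin s → Fin m, (q ^ s.choose 2) ^ 2 * ∏ j, if f j = g j then β ^ (s - 1) else 1 :=
          Finset.sum_le_sum fun g _ => hterm g
      _ = (q ^ s.choose 2) ^ 2 * ∏ j : Fin s, ∑ x : Fin m, if f j = x then β ^ (s - 1) else 1 := by
          rw [← Finset.mul_sum, Finset.prod_univ_sum, Fintype.piFinset_univ]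
      _ ≤ (q ^ s.choose 2) ^ 2 * ∏ j : Fin s, (m + β ^ (s - 1)) := by
          refine mul_le_mul_of_nonneg_left (Finset.prod_le_prod (fun j _ => ?_) fun j _ => ?_)
            (by positivity)
          · exact Finset.sum_nonneg fun x _ => by split_ifs <;> positivity
          · calc ∑ x : Fin m, (if f j = x then β ^ (s - 1) else 1)
                ≤ ∑ x : Fin m, (1 + if f j = x then β ^ (s - 1) else 0) :=
                  Finset.sum_le_sum fun x _ => by split_ifs <;> simp
              _ = _ := by simp [Finset.sum_add_distrib]
      _ = _ := by
          have : (m : ℝ) + β ^ (s - 1) = m * (1 + β ^ (s - 1) / m) := by field_simp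
          simp only [Finset.prod_const, Finset.card_univ, Fintype.card_fin, this, mul_pow,
            Fintype.card_fun]
          push_cast
          ring

/-! ### Bounds on the saturation number -/

theorem le_two_mul_satNumber_starK {k s : ℕ} {G : SimpleGraph V}
    (hs : ∀ A : Finset V, A.card = s → ∃ v ∈ A, k ≤ (A.filter (G.Adj v)).card) :
    k * Fintype.card V + k ≤ 2 * G.satNumber (starK (k + 1)) + k * s := by
  obtain ⟨H, hH, hc⟩ := exists_ncard_edgeSet_eq_satNumber_starK G (k + 1) (Nat.le_add_left 1 k)
  rw [← hc]
  exact hH.le_two_mul_ncard_edgeSet hs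

theorem two_mul_satNumber_starK_le {k L : ℕ} {G : SimpleGraph V} {S : Finset V} (hk1 : 1 ≤ k)
    (hS : ∀ u ∈ S, ∀ v ∈ S, ¬ G.Adj u v)
    (hL : ∀ Y Z : Finset V, Y.card = L → Z.card = L → Disjoint Y Z → ∃ y ∈ Y, ∃ z ∈ Z, G.Adj y z)
    (hdeg : ∀ v, S.card + (k + 1) ^ 2 * (2 * (k * L) + 2) + k * L ≤ G.degree v) :
    2 * G.satNumber (starK (k + 1)) + k * S.card ≤ k * Fintype.card V + k := by
  obtain ⟨H₀, hle, hk, h0, hdef⟩ := exists_almost_regular S hk1 hL hdeg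
  obtain ⟨H, hH, hc⟩ := exists_isSaturatedSubgraph_of_almost_regular hS hle hk h0 hdef
  have : G.satNumber (starK (k + 1)) ≤ H.edgeSet.ncard := Nat.sInf_le ⟨H, hH, rfl⟩
  omega

/-- A non-asymptotic bound for the probability that the star saturation number of the random graph
deviates from its typical value. -/
theorem binomialRandom_real_satNumber_starK_le (p : unitInterval) (hp1 : p < 1)
    {k s t m L D : ℕ} (hk1 : 1 ≤ k) (hD : s + (k + 1) ^ 2 * (2 * (k * L) + 2) + k * L = D)
    (hDV : D ≤ Fintype.card V) (hm : 0 < m) (hsm : s * m ≤ Fintype.card V)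
    (ht : t * k ≤ t.choose 2) :
    (binomialRandom V p).real {G | ¬ (k * Fintype.card V + k ≤
      2 * G.satNumber (starK (k + 1)) + k * t ∧
      2 * G.satNumber (starK (k + 1)) + k * s ≤ k * Fintype.card V + k)} ≤
      (Fintype.card V ^ 2 * (1 - (p : ℝ)) ^ L) ^ L +
      (Fintype.card V : ℝ) ^ (D + 1) * (1 - (p : ℝ)) ^ (Fintype.card V - D) +
      (Fintype.card V : ℝ) ^ t * ((t : ℝ) ^ 2) ^ (t * k) *
        (1 - (p : ℝ)) ^ (t.choose 2 - t * k) +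
      ((1 + √(1 / (1 - (p : ℝ))) ^ (s - 1) / m) ^ s - 1) := by
  refine le_trans ?_ (add_le_add (add_le_add (add_le_add
    (binomialRandom_real_exists_no_edges_between_le (V := V) p L)
    (binomialRandom_real_exists_degree_lt_le (V := V) p hDV))
    (binomialRandom_real_exists_sparse_le (V := V) p ht))
    (binomialRandom_real_no_independent_le (V := V) p hp1 hm hsm))
  refine le_trans ?_ (add_le_add_left (add_le_add_left (measureReal_union_le _ _) _) _)
  refine le_trans ?_ (add_le_add_left (measureReal_union_le _ _) _)
  refine le_trans ?_ (measureReal_union_le _ _)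
  refine measureReal_mono (fun G hG => ?_) (measure_ne_top _ _)
  by_contra hcon
  simp only [Set.mem_union, Set.mem_ofPred_eq, not_or, not_not] at hcon
  obtain ⟨⟨⟨h1, h2⟩, h3⟩, S, hSc, hS⟩ := hcon
  refine hG ⟨le_two_mul_satNumber_starK h3, ?_⟩
  subst hSc
  exact two_mul_satNumber_starK_le hk1 hS h1 fun v => hD.trans_le (h2 v)

end SimpleGraph

/-! ### Asymptotics of the error terms -/

namespace SimpleGraph

section asymptotics

variable {q : ℝ}

theorem one_lt_one_div_of_pos_of_lt_one (hq0 : 0 < q) (hq1 : q < 1) : 1 < 1 / q :=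
  (one_lt_div hq0).2 hq1

theorem rpow_mul_logb_one_div (hq0 : 0 < q) (hq1 : q < 1) {x : ℝ} (hx : 0 < x) (c : ℝ) :
    q ^ (c * Real.logb (1 / q) x) = x ^ (-c) := by
  have hb := one_lt_one_div_of_pos_of_lt_one hq0 hq1
  have : q = (1 / q) ^ (-1 : ℝ) := by
    rw [Real.rpow_neg_one, one_div, inv_inv]
  calc q ^ (c * Real.logb (1 / q) x) = ((1 / q) ^ (-1 : ℝ)) ^ (c * Real.logb (1 / q) x) := by
        rw [← this]
    _ = (1 / q) ^ (Real.logb (1 / q) x * (-c)) := by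
        rw [← Real.rpow_mul (by positivity)]
        congr 1
        ring
    _ = x ^ (-c) := by
        rw [Real.rpow_mul (by positivity), Real.rpow_logb (by positivity) hb.ne' hx]

theorem tendsto_logb_one_div_natCast (hq0 : 0 < q) (hq1 : q < 1) :
    Tendsto (fun n : ℕ => Real.logb (1 / q) n) atTop atTop :=
  (Real.tendsto_logb_atTop (one_lt_one_div_of_pos_of_lt_one hq0 hq1)).comp
    tendsto_natCast_atTop_atTop

theorem eventually_mul_logb_pow_le_rpow (hq0 : 0 < q) (hq1 : q < 1) (K : ℝ) (j : ℕ) {δ : ℝ}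
    (hδ : 0 < δ) : ∀ᶠ n : ℕ in atTop, K * Real.logb (1 / q) n ^ j ≤ (n : ℝ) ^ δ := by
  have hb : 0 < Real.log (1 / q) := Real.log_pos (one_lt_one_div_of_pos_of_lt_one hq0 hq1)
  set a : ℝ := |K| / Real.log (1 / q) ^ j + 1 with ha
  have ha0 : 0 < a := by positivity
  have h := (isLittleO_log_rpow_rpow_atTop (j : ℝ) hδ).bound (inv_pos.2 ha0)
  filter_upwards [tendsto_natCast_atTop_atTop.eventually h, eventually_ge_atTop 1] with n hn hn1
  have hn1' : (1 : ℝ) ≤ n := by exact_mod_cast hn1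
  have hlog : 0 ≤ Real.log n := Real.log_nonneg hn1'
  rw [Real.rpow_natCast, Real.norm_of_nonneg (by positivity), Real.norm_of_nonneg (by positivity),
    inv_mul_eq_div, le_div_iff₀ ha0] at hn
  refine le_trans ?_ hn
  rw [Real.logb, div_pow, ← mul_div_assoc, mul_comm K, mul_div_assoc]
  refine mul_le_mul_of_nonneg_left ?_ (by positivity)
  rw [ha]
  have := div_le_div_of_nonneg_right (le_abs_self K) (pow_nonneg hb.le j)
  linarith

theorem eventually_pow_ceil_logb_le (hq0 : 0 < q) (hq1 : q < 1) :
    ∀ᶠ n : ℕ in atTop, ((n : ℝ) ^ 2 * q ^ ⌈3 * Real.logb (1 / q) n⌉₊) ^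
      ⌈3 * Real.logb (1 / q) n⌉₊ ≤ (n : ℝ)⁻¹ := by
  filter_upwards [(tendsto_logb_one_div_natCast hq0 hq1).eventually_ge_atTop 1,
    eventually_ge_atTop 1] with n hl hn1
  have hn1' : (1 : ℝ) ≤ n := by exact_mod_cast hn1
  have hn0 : (0 : ℝ) < n := one_pos.trans_le hn1'
  set L := ⌈3 * Real.logb (1 / q) n⌉₊ with hL
  have hL1 : L ≠ 0 := by
    have : 0 < L := Nat.ceil_pos.2 (by linarith)
    omega
  have h1 : q ^ L ≤ (n : ℝ) ^ (-3 : ℝ) := by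
    rw [← rpow_mul_logb_one_div hq0 hq1 hn0, ← Real.rpow_natCast]
    exact Real.rpow_le_rpow_of_exponent_ge hq0 hq1.le (Nat.le_ceil _)
  have h2 : (n : ℝ) ^ 2 * q ^ L ≤ (n : ℝ)⁻¹ := by
    calc (n : ℝ) ^ 2 * q ^ L ≤ (n : ℝ) ^ 2 * (n : ℝ) ^ (-3 : ℝ) := by gcongr
      _ = (n : ℝ)⁻¹ := by
        rw [← Real.rpow_natCast, ← Real.rpow_add hn0, ← Real.rpow_neg_one]
        norm_num
  exact (pow_le_of_le_one (by positivity) (h2.trans (inv_le_one_of_one_le₀ hn1')) hL1).trans h2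

/-- With `l = log_{1/q} n`, the left side is `q` to the power `n - D - l (D + 1)`, where the
subtracted terms are `O(l ^ 2)`, so the exponent eventually exceeds `l`. -/
theorem eventually_pow_mul_pow_sub_le (hq0 : 0 < q) (hq1 : q < 1) {D : ℕ → ℕ} {C : ℝ}
    (hD : ∀ᶠ n : ℕ in atTop, (D n : ℝ) ≤ C * Real.logb (1 / q) n) :
    ∀ᶠ n : ℕ in atTop, D n ≤ n ∧ (n : ℝ) ^ (D n + 1) * q ^ (n - D n) ≤ (n : ℝ)⁻¹ := by
  filter_upwards [hD, (tendsto_logb_one_div_natCast hq0 hq1).eventually_ge_atTop 1,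
    eventually_ge_atTop 1, eventually_mul_logb_pow_le_rpow hq0 hq1 (2 * |C| + 2) 2 one_pos]
    with n hDn hl hn1 hbig
  have hn1' : (1 : ℝ) ≤ n := by exact_mod_cast hn1
  have hn0 : (0 : ℝ) < n := one_pos.trans_le hn1'
  rw [Real.rpow_one] at hbig
  set l := Real.logb (1 / q) n with hldef
  have hDC : (D n : ℝ) ≤ |C| * l := hDn.trans (by gcongr; exact le_abs_self C)
  have hC := abs_nonneg C
  have hll : l ≤ l ^ 2 := by nlinarith
  have hCl : |C| * l ≤ |C| * l ^ 2 := by gcongr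
  have hDl : D n * l ≤ |C| * l ^ 2 := by nlinarith
  have hexp : l ≤ (n : ℝ) - D n - l * (D n + 1) := by nlinarith
  have hDle : D n ≤ n := by
    have : (D n : ℝ) ≤ n := by nlinarith [Nat.cast_nonneg (α := ℝ) (D n)]
    exact_mod_cast this
  refine ⟨hDle, ?_⟩
  have h1 : (n : ℝ) ^ (D n + 1) = q ^ (-(l * (D n + 1))) := by
    rw [show -(l * ((D n : ℝ) + 1)) = (-((D n : ℝ) + 1)) * l by ring,
      rpow_mul_logb_one_div hq0 hq1 hn0, neg_neg]
    exact_mod_cast (Real.rpow_natCast (n : ℝ) (D n + 1)).symm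
  have h2 : (n : ℝ)⁻¹ = q ^ l := by
    rw [← Real.rpow_neg_one, ← rpow_mul_logb_one_div hq0 hq1 hn0, one_mul]
  rw [h1, h2, ← Real.rpow_natCast q, Nat.cast_sub hDle, ← Real.rpow_add hq0]
  exact Real.rpow_le_rpow_of_exponent_ge hq0 hq1.le (by linarith)

theorem eventually_sparse_bound_le (hq0 : 0 < q) (hq1 : q < 1) (k : ℕ) {ε : ℝ} (hε : 0 < ε)
    (hε1 : ε ≤ 1) {t : ℕ → ℕ} (ht : ∀ n, t n = ⌊(2 + 2 * ε) * Real.logb (1 / q) n⌋₊ + 1) :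
    ∀ᶠ n : ℕ in atTop, t n * k ≤ (t n).choose 2 ∧ (n : ℝ) ^ t n * ((t n : ℝ) ^ 2) ^ (t n * k) *
      q ^ ((t n).choose 2 - t n * k) ≤ (n : ℝ) ^ (-(ε / 2)) := by
  filter_upwards [(tendsto_logb_one_div_natCast hq0 hq1).eventually_ge_atTop (k + 1 : ℝ),
    eventually_ge_atTop 1, eventually_mul_logb_pow_le_rpow hq0 hq1
      (q ^ (-(1 / 2 + k : ℝ)) * 25 ^ k) (2 * k) (half_pos hε)] with n hl hn1 hbig
  have hn1' : (1 : ℝ) ≤ n := by exact_mod_cast hn1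
  have hn0 : (0 : ℝ) < n := one_pos.trans_le hn1'
  have hk0 : (0 : ℝ) ≤ k := Nat.cast_nonneg k
  set l := Real.logb (1 / q) n with hldef
  set s := t n with hs
  have hs1 : (2 + 2 * ε) * l ≤ s := by
    rw [hs, ht]; push_cast; exact (Nat.lt_floor_add_one _).le
  have hs2 : (s : ℝ) ≤ (2 + 2 * ε) * l + 1 := by
    rw [hs, ht]; push_cast
    have := Nat.floor_le (show 0 ≤ (2 + 2 * ε) * l by nlinarith)
    linarith
  have hl0 : 0 ≤ l := by linarith
  have hs5 : (s : ℝ) ≤ 5 * l := by nlinarith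
  have hs0 : s ≠ 0 := by rw [hs, ht]; omega
  have hchoose : ((s.choose 2 : ℕ) : ℝ) = s * (s - 1) / 2 := Nat.cast_choose_two ℝ s
  have hle : s * k ≤ s.choose 2 := by
    have : (s : ℝ) * k ≤ s * (s - 1) / 2 := by
      have : (2 * k : ℝ) ≤ s - 1 := by nlinarith
      nlinarith [Nat.cast_nonneg (α := ℝ) s]
    rw [← hchoose] at this
    exact_mod_cast this
  refine ⟨hle, ?_⟩
  -- The whole bound is the `s`-th power of `n s ^ (2k) q ^ ((s - 1)/2 - k)`. Since `s ≥ (2 + 2ε)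
  -- l`, this base is `n ^ (-ε)` times a polylogarithmic factor.
  have hq : q ^ (s.choose 2 - s * k) = (q ^ ((s - 1 : ℝ) / 2 - k)) ^ s := by
    rw [← Real.rpow_natCast, ← Real.rpow_natCast, ← Real.rpow_mul hq0.le, Nat.cast_sub hle, hchoose]
    congr 1
    push_cast
    ring
  have hinner : (n : ℝ) * ((s : ℝ) ^ 2) ^ k * q ^ ((s - 1 : ℝ) / 2 - k) ≤ (n : ℝ) ^ (-(ε / 2)) := by
    have h1 : q ^ ((s - 1 : ℝ) / 2 - k) ≤ (n : ℝ) ^ (-(1 + ε)) * q ^ (-(1 / 2 + k : ℝ)) := by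
      rw [← rpow_mul_logb_one_div hq0 hq1 hn0, ← Real.rpow_add hq0]
      refine Real.rpow_le_rpow_of_exponent_ge hq0 hq1.le ?_
      linarith
    have h2 : ((s : ℝ) ^ 2) ^ k ≤ 25 ^ k * l ^ (2 * k) := by
      calc ((s : ℝ) ^ 2) ^ k ≤ ((5 * l) ^ 2) ^ k := by gcongr
        _ = _ := by rw [mul_pow, mul_pow, ← pow_mul l]; norm_num
    calc (n : ℝ) * ((s : ℝ) ^ 2) ^ k * q ^ ((s - 1 : ℝ) / 2 - k)
        ≤ n * (25 ^ k * l ^ (2 * k)) * ((n : ℝ) ^ (-(1 + ε)) * q ^ (-(1 / 2 + k : ℝ))) := by gcongr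
      _ = n * (n : ℝ) ^ (-(1 + ε)) * (q ^ (-(1 / 2 + k : ℝ)) * 25 ^ k * l ^ (2 * k)) := by ring
      _ ≤ n * (n : ℝ) ^ (-(1 + ε)) * (n : ℝ) ^ (ε / 2) := by gcongr
      _ = (n : ℝ) ^ (-(ε / 2)) := by
        nth_rewrite 1 [← Real.rpow_one (n : ℝ)]
        rw [← Real.rpow_add hn0, ← Real.rpow_add hn0]
        congr 1
        ring
  rw [hq, mul_comm s k, pow_mul, ← mul_pow, ← mul_pow]
  refine (pow_le_of_le_one (by positivity) (hinner.trans ?_) hs0).trans hinner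
  exact Real.rpow_le_one_of_one_le_of_nonpos hn1' (by linarith)

theorem eventually_independent_bound_le (hq0 : 0 < q) (hq1 : q < 1) {ε : ℝ} (hε : 0 < ε)
    (hε1 : ε ≤ 1) {s : ℕ → ℕ} (hs : ∀ n, s n = ⌊(2 - ε) * Real.logb (1 / q) n⌋₊) :
    ∀ᶠ n : ℕ in atTop, 0 < n / s n ∧
      (1 + √(1 / q) ^ (s n - 1) / (n / s n : ℕ)) ^ s n - 1 ≤
        Real.exp ((n : ℝ) ^ (-(ε / 4))) - 1 := by
  filter_upwards [(tendsto_logb_one_div_natCast hq0 hq1).eventually_ge_atTop 1,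
    eventually_ge_atTop 1, eventually_mul_logb_pow_le_rpow hq0 hq1 4 1 one_pos,
    eventually_mul_logb_pow_le_rpow hq0 hq1 8 2 (show 0 < ε / 4 by positivity)]
    with n hl hn1 hbig1 hbig2
  have hn1' : (1 : ℝ) ≤ n := by exact_mod_cast hn1
  have hn0 : (0 : ℝ) < n := one_pos.trans_le hn1'
  rw [Real.rpow_one, pow_one] at hbig1
  set l := Real.logb (1 / q) n with hldef
  set r := s n with hr
  have hr1 : (r : ℝ) ≤ (2 - ε) * l := by
    rw [hr, hs]; exact Nat.floor_le (by nlinarith)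
  have hr2 : (r : ℝ) ≤ 2 * l := by nlinarith
  have hr0 : 0 < r := by
    rw [hr, hs]; exact Nat.floor_pos.2 (by nlinarith)
  have hr0' : (0 : ℝ) < r := by exact_mod_cast hr0
  -- Rounding `n / r` down loses less than `r ≤ 2 l ≤ n / 2` after multiplication by `r`.
  have hm : (n : ℝ) / 2 ≤ (n / r : ℕ) * r := by
    have : n < (n / r + 1) * r := by
      rw [mul_comm]; exact Nat.lt_mul_div_succ n hr0
    have : (n : ℝ) < ((n / r : ℕ) + 1) * r := by exact_mod_cast this
    linarith
  have hm0' : (0 : ℝ) < (n / r : ℕ) := by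
    by_contra h
    nlinarith
  have hm0 : 0 < n / r := by exact_mod_cast hm0'
  refine ⟨hm0, ?_⟩
  have hb : 1 < 1 / q := one_lt_one_div_of_pos_of_lt_one hq0 hq1
  have hβ : √(1 / q) ^ (r - 1) ≤ (n : ℝ) ^ (1 - ε / 2) := by
    calc √(1 / q) ^ (r - 1) ≤ √(1 / q) ^ r :=
          pow_le_pow_right₀ (Real.one_le_sqrt.2 hb.le) (Nat.sub_le r 1)
      _ = (1 / q) ^ ((r : ℝ) / 2) := by
          rw [Real.sqrt_eq_rpow, ← Real.rpow_natCast, ← Real.rpow_mul (by positivity)]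
          congr 1
          ring
      _ ≤ (1 / q) ^ (l * (1 - ε / 2)) :=
          Real.rpow_le_rpow_of_exponent_le hb.le (by nlinarith)
      _ = (n : ℝ) ^ (1 - ε / 2) := by
          rw [Real.rpow_mul (by positivity), Real.rpow_logb (by positivity) hb.ne' hn0]
  have hx : r * (√(1 / q) ^ (r - 1) / (n / r : ℕ)) ≤ (n : ℝ) ^ (-(ε / 4)) := by
    rw [← mul_div_assoc, div_le_iff₀ hm0']
    have h1 : (r : ℝ) * r ≤ 4 * l ^ 2 := by nlinarith
    have h2 : (n : ℝ) ^ (1 - ε / 2) * (n : ℝ) ^ (ε / 4) = (n : ℝ) ^ (-(ε / 4)) * n := by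
      nth_rewrite 4 [← Real.rpow_one (n : ℝ)]
      rw [← Real.rpow_add hn0, ← Real.rpow_add hn0]
      congr 1
      ring
    have h3 : (r * √(1 / q) ^ (r - 1)) * r ≤ ((n : ℝ) ^ (-(ε / 4)) * (n / r : ℕ)) * r := by
      calc (r * √(1 / q) ^ (r - 1)) * r = (r * r) * √(1 / q) ^ (r - 1) := by ring
        _ ≤ (4 * l ^ 2) * (n : ℝ) ^ (1 - ε / 2) := by gcongr
        _ = (8 * l ^ 2) * (n : ℝ) ^ (1 - ε / 2) / 2 := by ring
        _ ≤ (n : ℝ) ^ (ε / 4) * (n : ℝ) ^ (1 - ε / 2) / 2 := by gcongr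
        _ = (n : ℝ) ^ (-(ε / 4)) * (n / 2) := by rw [mul_comm, ← mul_div_assoc, ← h2]
        _ ≤ (n : ℝ) ^ (-(ε / 4)) * ((n / r : ℕ) * r) := by gcongr
        _ = _ := by ring
    exact le_of_mul_le_mul_right h3 hr0'
  gcongr
  calc (1 + √(1 / q) ^ (r - 1) / (n / r : ℕ)) ^ r
      ≤ Real.exp (√(1 / q) ^ (r - 1) / (n / r : ℕ)) ^ r := by
        gcongr
        rw [add_comm]
        exact Real.add_one_le_exp _
    _ = Real.exp (r * (√(1 / q) ^ (r - 1) / (n / r : ℕ))) := (Real.exp_nat_mul _ _).symm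
    _ ≤ _ := Real.exp_le_exp.2 hx

end asymptotics

/-! ### Concentration and the main theorem -/

open MeasureTheory

/-- The star saturation number of the random graph is concentrated. -/
theorem tendsto_binomialRandom_real_satNumber_starK (p : unitInterval) (hp0 : 0 < p) (hp1 : p < 1)
    {k : ℕ} (hk : 1 ≤ k) {ε : ℝ} (hε : 0 < ε) (hε1 : ε ≤ 1) :
    Tendsto (fun n : ℕ => (binomialRandom (Fin n) p).real {G | k * n + k ≤
      2 * G.satNumber (starK (k + 1)) +
        k * (⌊(2 + 2 * ε) * Real.logb (1 / (1 - (p : ℝ))) n⌋₊ + 1) ∧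
      2 * G.satNumber (starK (k + 1)) +
        k * ⌊(2 - ε) * Real.logb (1 / (1 - (p : ℝ))) n⌋₊ ≤ k * n + k}) atTop (𝓝 1) := by
  have hq0 : 0 < 1 - (p : ℝ) := sub_pos.2 hp1
  have hq1 : 1 - (p : ℝ) < 1 := sub_lt_self _ hp0
  set q : ℝ := 1 - (p : ℝ) with hq
  set t : ℕ → ℕ := fun n => ⌊(2 + 2 * ε) * Real.logb (1 / q) n⌋₊ + 1 with ht
  set s : ℕ → ℕ := fun n => ⌊(2 - ε) * Real.logb (1 / q) n⌋₊ with hs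
  set L : ℕ → ℕ := fun n => ⌈3 * Real.logb (1 / q) n⌉₊ with hL
  set D : ℕ → ℕ := fun n => s n + (k + 1) ^ 2 * (2 * (k * L n) + 2) + k * L n with hD
  -- Once `l ≥ 1`, the ceiling gives `L ≤ 4 l` and the constant `2` is at most `2 l`.
  have hDC : ∀ᶠ n : ℕ in atTop, (D n : ℝ) ≤
      (2 + (k + 1) ^ 2 * (2 * (k * 4) + 2) + k * 4) * Real.logb (1 / q) n := by
    filter_upwards [(tendsto_logb_one_div_natCast hq0 hq1).eventually_ge_atTop 1] with n hl
    have h1 : (s n : ℝ) ≤ 2 * Real.logb (1 / q) n :=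
      (Nat.floor_le (by nlinarith)).trans (by nlinarith)
    have h2 : (L n : ℝ) ≤ 4 * Real.logb (1 / q) n := by
      have := Nat.ceil_lt_add_one (show 0 ≤ 3 * Real.logb (1 / q) n by linarith)
      simp only [hL]
      linarith
    simp only [hD]
    push_cast
    calc (s n : ℝ) + (k + 1) ^ 2 * (2 * (k * L n) + 2) + k * L n
        ≤ 2 * Real.logb (1 / q) n + (k + 1) ^ 2 * (2 * (k * (4 * Real.logb (1 / q) n)) +
          2 * Real.logb (1 / q) n) + k * (4 * Real.logb (1 / q) n) := by
          gcongr
          linarith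
      _ = _ := by ring
  have hinv : Tendsto (fun n : ℕ => (n : ℝ)⁻¹) atTop (𝓝 0) := tendsto_inv_atTop_nhds_zero_nat
  have hpow : ∀ δ : ℝ, 0 < δ → Tendsto (fun n : ℕ => (n : ℝ) ^ (-δ)) atTop (𝓝 0) := fun δ hδ =>
    (tendsto_rpow_neg_atTop hδ).comp tendsto_natCast_atTop_atTop
  have hexp : Tendsto (fun n : ℕ => Real.exp ((n : ℝ) ^ (-(ε / 4))) - 1) atTop (𝓝 0) := by
    have := (Real.continuous_exp.tendsto 0).comp (hpow (ε / 4) (by positivity))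
    simpa using this.sub_const 1
  have hsum := ((hinv.add hinv).add (hpow (ε / 2) (by positivity))).add hexp
  simp only [add_zero] at hsum
  refine tendsto_of_tendsto_of_tendsto_of_le_of_le' (by simpa using hsum.const_sub 1)
    tendsto_const_nhds ?_ (Eventually.of_forall fun n => measureReal_le_one)
  filter_upwards [eventually_pow_ceil_logb_le hq0 hq1, eventually_pow_mul_pow_sub_le hq0 hq1 hDC,
    eventually_sparse_bound_le hq0 hq1 k hε hε1 (t := t) fun _ => rfl,
    eventually_independent_bound_le hq0 hq1 hε hε1 (s := s) fun _ => rfl]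
    with n h1 h2 h3 h4
  have key := binomialRandom_real_satNumber_starK_le (V := Fin n) p hp1 (k := k) (s := s n)
    (t := t n) (m := n / s n) (L := L n) (D := D n) hk rfl (by simpa using h2.1) h4.1
    (by simpa using Nat.mul_div_le n (s n)) h3.1
  simp only [Fintype.card_fin] at key
  have hcompl := probReal_compl_eq_one_sub (μ := binomialRandom (Fin n) p)
    (s := {G | ¬ (k * n + k ≤ 2 * G.satNumber (starK (k + 1)) + k * t n ∧
      2 * G.satNumber (starK (k + 1)) + k * s n ≤ k * n + k)}) (Set.toFinite _).measurableSet
  have hset : {G : SimpleGraph (Fin n) | ¬ (k * n + k ≤ 2 * G.satNumber (starK (k + 1)) + k * t n ∧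
      2 * G.satNumber (starK (k + 1)) + k * s n ≤ k * n + k)}ᶜ =
      {G | k * n + k ≤ 2 * G.satNumber (starK (k + 1)) + k * t n ∧
      2 * G.satNumber (starK (k + 1)) + k * s n ≤ k * n + k} := by
    ext G
    simp only [Set.mem_compl_iff, Set.mem_ofPred_eq, not_not]
  rw [hset] at hcompl
  rw [hcompl]
  have := h2.2
  have := h3.2
  have := h4.2
  linarith

end SimpleGraph

theorem mainTheorem1 (p : unitInterval) (hp0 : 0 < p) (hp1 : p < 1) (r : ℕ) (hr : 2 ≤ r) :
    ∃ X : (n : ℕ) → SimpleGraph (Fin n) → ℝ,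
      SimpleGraph.IsLittleOOneWhp p X ∧
      ∀ n : ℕ, 2 ≤ n → ∀ G : SimpleGraph (Fin n),
        (G.satNumber (SimpleGraph.starK r) : ℝ) =
          ((r : ℝ) - 1) * (n : ℝ) / 2 -
            (1 + X n G) * ((r : ℝ) - 1) * Real.logb (1 / (1 - (p : ℝ))) (n : ℝ) := by
  obtain ⟨k, rfl⟩ : ∃ k, r = k + 1 := ⟨r - 1, by omega⟩
  have hk : 1 ≤ k := by omega
  have hk' : (0 : ℝ) < k := by exact_mod_cast hk
  have hq0 : 0 < 1 - (p : ℝ) := sub_pos.2 hp1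
  have hq1 : 1 - (p : ℝ) < 1 := sub_lt_self _ hp0
  have hb := SimpleGraph.one_lt_one_div_of_pos_of_lt_one hq0 hq1
  simp only [Nat.cast_add, Nat.cast_one, add_sub_cancel_right]
  -- `X` is obtained by solving the claimed identity; the logarithm is nonzero for `n ≥ 2`.
  refine ⟨fun n G => ((k : ℝ) * n / 2 - G.satNumber (SimpleGraph.starK (k + 1))) /
    (k * Real.logb (1 / (1 - (p : ℝ))) n) - 1, fun ε hε => ?_, fun n hn G => ?_⟩
  · set δ := min ε 1 with hδ
    have hδ0 : 0 < δ := lt_min hε one_pos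
    refine tendsto_of_tendsto_of_tendsto_of_le_of_le'
      (SimpleGraph.tendsto_binomialRandom_real_satNumber_starK p hp0 hp1 hk hδ0 (min_le_right _ _))
      tendsto_const_nhds ?_ (Eventually.of_forall fun n => MeasureTheory.measureReal_le_one)
    -- The floor and the additive `k` cost `2 k` in the upper bound on `sat`, absorbed by `2 ≤ δ l`:
    -- the coefficient `2 - δ` drops to `2 - 2 δ`. In the lower bound the `+ 1` and the `+ k`
    -- cancel.
    filter_upwards [(SimpleGraph.tendsto_logb_one_div_natCast hq0 hq1).eventually_ge_atTop (2 / δ)]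
      with n hl
    refine MeasureTheory.measureReal_mono (fun G hG => ?_) (MeasureTheory.measure_ne_top _ _)
    obtain ⟨h1, h2⟩ := hG
    simp only [Set.mem_ofPred_eq]
    set l := Real.logb (1 / (1 - (p : ℝ))) n
    have hl0 : 0 < l := lt_of_lt_of_le (by positivity) hl
    have hδl : 2 ≤ δ * l := by
      rwa [div_le_iff₀ hδ0, mul_comm] at hl
    have hδε : δ ≤ ε := min_le_left _ _
    have hδ1 : δ ≤ 1 := min_le_right _ _
    set S := G.satNumber (SimpleGraph.starK (k + 1))
    have hf1 : (⌊(2 + 2 * δ) * l⌋₊ : ℝ) ≤ (2 + 2 * δ) * l := Nat.floor_le (by positivity)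
    have hf2 := (Nat.lt_floor_add_one ((2 - δ) * l)).le
    have h1' : (k : ℝ) * n + k ≤ 2 * S + k * (⌊(2 + 2 * δ) * l⌋₊ + 1) := by exact_mod_cast h1
    have h2' : 2 * (S : ℝ) + k * ⌊(2 - δ) * l⌋₊ ≤ k * n + k := by exact_mod_cast h2
    have h3 : (k : ℝ) * n / 2 - S ≤ (1 + δ) * (k * l) := by
      have := mul_le_mul_of_nonneg_left hf1 hk'.le
      linarith
    have h4 : (1 - δ) * (k * l) ≤ (k : ℝ) * n / 2 - S := by
      have := mul_le_mul_of_nonneg_left hf2 hk'.le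
      have := mul_le_mul_of_nonneg_left hδl hk'.le
      linarith
    have hkl : 0 < k * l := by positivity
    have h5 := (div_le_iff₀ hkl).2 h3
    have h6 := (le_div_iff₀ hkl).2 h4
    rw [abs_le]
    constructor <;> linarith
  · have hl : Real.logb (1 / (1 - (p : ℝ))) n ≠ 0 :=
      (Real.logb_pos hb (by exact_mod_cast hn)).ne'
    field_simp
    ring
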